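/- Let $H$ be a finite connected digraph (loops and parallel edges allowed) that is 2-regular, i.e. every vertex has indegree two and outdegree two. Embeddings in the 2-sphere are described combinatorially. A 2-cell embedding of the underlying graph in a closed oriented surface is given by a rotation system: for every vertex $v$, a cyclic order (counterclockwise) of the half-edges attached at $v$. Its facial walks are obtained by repeatedly traversing an edge to its far end and leaving that end along the half-edge that comes next in the rotation there; the surface is the sphere if and only if $|V(H)|-|E(H)|+|F|=2$, where $F$ is the set of faces. An embedding of $H$ in the 2-sphere is such an embedding, with $|V(H)|-|E(H)|+|F|=2$, in which every face is bounded by a directed walk (equivalently, the edges at each vertex alternate in-out-in-out). Two embeddings are equivalent if they have the same facial walks, where closed walks are regarded up to the choice of starting point and of direction of traversal. A Whitney flip reflects a closed disc $\mathcal D$ in the sphere whose boundary meets $H$ in exactly two points, which are interior points of two different edges $e$ and $f$ at which the boundary crosses these edges; the reflection fixes the two crossing points. In combinatorial terms, if $X$ is the set of vertices in $\mathcal D$, then $e$ and $f$ are exactly the edges with one end in $X$ and one end outside $X$, the two arcs of the boundary of $\mathcal D$ between the crossing points run through the face whose walk leaves $X$ along $e$ and enters $X$ along $f$, and through the face whose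 walk leaves $X$ along $f$ and enters $X$ along $e$; the flip reverses the cyclic order at every vertex of $X$ and leaves the cyclic order at every other vertex unchanged. Theorem (digraph analogue of Whitney's theorem). If $\phi_1$ and $\phi_2$ are embeddings of a connected 2-regular digraph $H$ in the 2-sphere, then there is a finite (possibly empty) sequence of Whitney flips that transforms $\phi_1$ into an embedding equivalent to $\phi_2$. -/

import Mathlib

/-- A digraph with vertex set `V` and edge set `E`; loops and parallel edges are allowed. -/
structure MultiDigraph (V E : Type*) where
  tail : E → V
  head : E → V

namespace MultiDigraph

variable {V E : Type*}

/-- Every vertex has indegree two and outdegree two. -/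
def IsTwoRegular (H : MultiDigraph V E) : Prop :=
  ∀ v : V, {e : E | H.head e = v}.ncard = 2 ∧ {e : E | H.tail e = v}.ncard = 2

/-- The underlying undirected graph is connected (in particular, it has a vertex). -/
def IsConnected (H : MultiDigraph V E) : Prop :=
  (SimpleGraph.fromRel fun u v : V => ∃ e : E, H.tail e = u ∧ H.head e = v).Connected

/-- The vertex at which a half-edge (dart) is attached. The dart `(e, true)` is the half of `e`
at its tail, and stands for `e` traversed forwards; the dart `(e, false)` is the half of `e` at
its head, and stands for `e` traversed backwards. -/
def base (H : MultiDigraph V E) (d : E × Bool) : V :=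
  if d.2 = true then H.tail d.1 else H.head d.1

/-- The other half of the same edge, that is, the same edge traversed the other way. -/
def opp : Equiv.Perm (E × Bool) where
  toFun d := (d.1, !d.2)
  invFun d := (d.1, !d.2)
  left_inv d := by simp
  right_inv d := by simp

/-- A rotation system: at every vertex a cyclic order of all the half-edges attached there.
This is the standard combinatorial description of a 2-cell embedding of a connected graph with
at least one edge in a closed oriented surface: `rot d` is the half-edge that follows `d`
counterclockwise around their common vertex. -/
structure RotationSystem (H : MultiDigraph V E) where
  rot : Equiv.Perm (E × Bool)
  base_rot : ∀ d, H.base (rot d) = H.base d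
  sameCycle_rot : ∀ d d', H.base d = H.base d' → rot.SameCycle d d'

namespace RotationSystem

variable {H : MultiDigraph V E}

/-- The face tracing permutation: traverse `d` to its far end, and leave that end along the
half-edge that follows in the rotation. Its cycles are the faces. -/
def facePerm (φ : H.RotationSystem) : Equiv.Perm (E × Bool) :=
  opp.trans φ.rot

/-- The set of faces: the cycles of the face tracing permutation, including its fixed points. -/
def Face (φ : H.RotationSystem) : Type _ :=
  Quotient (Equiv.Perm.SameCycle.setoid φ.facePerm)

/-- The Euler characteristic `|V| - |E| + |F|` of the surface. -/
noncomputable def eulerChar (φ : H.RotationSystem) : ℤ :=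
  (Nat.card V : ℤ) - (Nat.card E : ℤ) + (Nat.card φ.Face : ℤ)

/-- Every face is bounded by a directed walk: all the edges along a face are traversed forwards,
or all are traversed backwards. -/
def FacesDirected (φ : H.RotationSystem) : Prop :=
  ∀ d d', φ.facePerm.SameCycle d d' → d.2 = d'.2

/-- The facial walks: the closed walks that bound the faces. A closed walk is recorded as a cyclic
sequence of darts, and each facial walk appears in both of its directions of traversal. -/
def facialWalks (φ : H.RotationSystem) : Set (Cycle (E × Bool)) :=
  {w | ∃ d, w = Function.periodicOrbit φ.facePerm d ∨
    w = (Function.periodicOrbit φ.facePerm d).reverse.map opp}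

end RotationSystem

/-- An embedding of a connected 2-regular digraph in the 2-sphere: a 2-cell embedding of the
underlying graph in the closed oriented surface of Euler characteristic two such that every face
is bounded by a directed walk. -/
structure SphereEmbedding (H : MultiDigraph V E) extends RotationSystem H where
  facesDirected : toRotationSystem.FacesDirected
  eulerChar_eq : toRotationSystem.eulerChar = 2

namespace SphereEmbedding

variable {H : MultiDigraph V E}

/-- Two embeddings are equivalent if they have the same facial walks. -/
def Equivalent (φ ψ : H.SphereEmbedding) : Prop :=
  φ.facialWalks = ψ.facialWalks

/-- A closed disc in the sphere whose boundary crosses `H` in exactly two points, which are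
interior points of two different edges. The set `inside` consists of the vertices in the disc,
and `x`, `y` are the two crossed edges, as darts that leave the disc. The boundary of the disc is
a closed curve made of two arcs that join the two crossing points, each of them within a face:
one arc runs through the face whose walk leaves the disc along `x` and enters it along `y`, the
other through the face whose walk leaves along `y` and enters along `x`. Every edge that is not
crossed lies on one side of this curve. -/
structure FlipDisc (φ : H.SphereEmbedding) where
  inside : Set V
  x : E × Bool
  y : E × Bool
  edge_ne : x.1 ≠ y.1
  x_inside : H.base x ∈ inside
  x_outside : H.base (opp x) ∉ inside
  y_inside : H.base y ∈ inside
  y_outside : H.base (opp y) ∉ inside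
  not_crossed : ∀ e : E, e ≠ x.1 → e ≠ y.1 → (H.tail e ∈ inside ↔ H.head e ∈ inside)
  arc_xy : φ.facePerm.SameCycle x (opp y)
  arc_yx : φ.facePerm.SameCycle y (opp x)

/-- `ψ` is obtained from `φ` by reflecting a disc that crosses two edges: the reflection fixes the
two crossing points, reverses the cyclic order at each vertex inside the disc, and changes
nothing outside. -/
def IsWhitneyFlip (φ ψ : H.SphereEmbedding) : Prop :=
  ∃ D : φ.FlipDisc, ∀ d : E × Bool,
    (H.base d ∈ D.inside → ψ.rot d = φ.rot.symm d) ∧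
    (H.base d ∉ D.inside → ψ.rot d = φ.rot d)

end SphereEmbedding

end MultiDigraph

/-!
At a vertex of a 2-regular digraph, only two cyclic orders of the four half-edges alternate between
out and in, and they are reverses of each other. Hence two embeddings with directed faces differ by
reversing the rotation on a set `S` of vertices (`FacesDirected.exists_reversedOn`). The theorem is
proved by induction on the size of the edge cut of `S`. If the cut is empty, then by connectivity
`S` is empty or contains all vertices, and the embeddings are equal or mirror images. Otherwise it
suffices to find a set `X` whose cut has exactly two edges, both in the cut of `S`: for then `X` is
the inside of a disc that can be flipped, and the flip replaces `S` by `S ∆ X`, whose cut is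
smaller.

The set `X` comes from linear algebra over `𝔽₂`. Let `D` be the cut of `S`. Euler's formula says
that the edge sets orthogonal to all faces of an embedding in the sphere are exactly the cuts
(`RotationSystem.dotPerp_faceSpace`). A face of the first embedding and a face of the second run
along each other in the same direction outside `S` and in opposite directions inside `S`, so that
they share an even number of edges of `D` (`ReversedOn.sum_cut_edgeSum_mul`). Restricted to `D`,
the two face spaces are therefore orthogonal to each other, and the orthogonal complement of
either consists of cuts contained in `D`. So these cuts form a space of dimension at least
`|D| / 2`; on the other hand, its dimension is one less than the number of components of the graph
without `D` (`ReversedOn.card_cut_le`). Thus the cuts of these components have fewer than four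
edges on average, and since a cut of a 2-regular digraph has as many edges in one direction as in
the other, one of them has exactly two edges (`ReversedOn.exists_isTwoEdgeCut`).

That the flip of such an `X` is again an embedding in the sphere needs no topology either: a
directed face that leaves `X` has to return along the only edge in the other direction, whence the
number of faces does not decrease (`ReversedOn.card_face_le`), and it cannot increase because the
Euler characteristic of a connected surface is at most two (`RotationSystem.card_face_le`).
-/

/-! ### Linear algebra over the field with two elements -/

/-- The orthogonal complement of a space of vectors over `𝔽₂`, for the dot product. -/
def dotPerp {ι : Type*} [Fintype ι] (W : Submodule (ZMod 2) (ι → ZMod 2)) :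
    Submodule (ZMod 2) (ι → ZMod 2) where
  carrier := {x | ∀ w ∈ W, w ⬝ᵥ x = 0}
  add_mem' hx hy w hw := by rw [dotProduct_add, hx w hw, hy w hw, add_zero]
  zero_mem' w _ := dotProduct_zero w
  smul_mem' c x hx w hw := by rw [dotProduct_smul, hx w hw, smul_zero]

theorem finrank_add_finrank_dotPerp {ι : Type*} [Fintype ι]
    (W : Submodule (ZMod 2) (ι → ZMod 2)) :
    Module.finrank (ZMod 2) W + Module.finrank (ZMod 2) (dotPerp W) = Fintype.card ι := by
  classical
  let B : LinearMap.BilinForm (ZMod 2) (ι → ZMod 2) := dotProductBilin (ZMod 2) (ZMod 2)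
  have hB : B.IsSymm := ⟨fun x y => dotProduct_comm x y⟩
  have hbot : B.orthogonal ⊤ = ⊥ := by
    rw [eq_bot_iff]
    intro x hx
    refine (Submodule.mem_bot _).2 (funext fun i => ?_)
    have := hx (Pi.single i 1) trivial
    simpa [B, dotProductBilin] using this
  have h := B.finrank_add_finrank_orthogonal hB.isRefl W
  rw [hbot, inf_bot_eq, finrank_bot, add_zero, Module.finrank_fintype_fun_eq_card] at h
  exact h

theorem finrank_le_one_of_subset_constants {ι : Type*}
    (W : Submodule (ZMod 2) (ι → ZMod 2)) (hW : ∀ f ∈ W, ∀ i j, f i = f j) :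
    Module.finrank (ZMod 2) W ≤ 1 := by
  refine (Submodule.finrank_mono (t := Submodule.span (ZMod 2) {fun _ => 1}) ?_).trans
    (finrank_span_le_card _ |>.trans (by simp))
  intro f hf
  rcases isEmpty_or_nonempty ι with hι | ⟨⟨i⟩⟩
  · rw [Subsingleton.elim f 0]
    exact zero_mem _
  · refine Submodule.mem_span_singleton.2 ⟨f i, funext fun j => ?_⟩
    simpa using hW f hf i j

/-! ### Cycles of permutations -/

theorem Equiv.Perm.SameCycle.map_eq {α β : Type*} {π : Equiv.Perm α} {g : α → β}
    (hg : ∀ a, g (π a) = g a) {a b : α} (h : π.SameCycle a b) : g a = g b := by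
  obtain ⟨n, rfl⟩ := h
  induction n with
  | zero => simp
  | succ n ih => rw [add_comm, zpow_add, Equiv.Perm.mul_apply, zpow_one, hg, ih]
  | pred n ih =>
    rw [ih, ← hg ((π ^ (-(n : ℤ) - 1)) a), ← Equiv.Perm.mul_apply, ← zpow_one_add]
    congr 3
    ring

theorem Equiv.Perm.SameCycle.induction_on {α : Type*} [Finite α] {π : Equiv.Perm α}
    {P : α → Prop} {a b : α} (h : π.SameCycle a b) (ha : P a) (hP : ∀ c, P c → P (π c)) :
    P b := by
  obtain ⟨n, rfl⟩ := h.exists_nat_pow_eq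
  induction n with
  | zero => simpa using ha
  | succ n ih => rw [pow_succ', Equiv.Perm.mul_apply]; exact hP _ (ih ⟨n, by simp⟩)

/-- If `ρ` is the conjugate by `f` of the inverse of `π`, then the cycle of `ρ` is the image under
`f` of the reverse of a cycle of `π`. -/
theorem Function.periodicOrbit_eq_map_reverse {α : Type*} {π ρ f : Equiv.Perm α}
    (h : ∀ a, ρ (f (π a)) = f a) (a : α) :
    Function.periodicOrbit ρ (f (π.symm a)) = ((Function.periodicOrbit π a).reverse).map f := by
  have hpow (n : ℕ) : ρ^[n] (f (π.symm a)) = f ((π ^ (-(n + 1 : ℤ))) a) := by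
    induction n with
    | zero => simp
    | succ n ih =>
      have hstep : (π ^ (-(n + 1 : ℤ))) a = π ((π ^ (-((n + 1 : ℕ) + 1 : ℤ))) a) := by
        rw [← Equiv.Perm.mul_apply, ← zpow_one_add]
        congr 2
      rw [Function.iterate_succ_apply', ih, hstep, h]
  have hper : Function.minimalPeriod ρ (f (π.symm a)) = Function.minimalPeriod π a := by
    rw [Function.minimalPeriod_eq_minimalPeriod_iff]
    intro n
    rw [Function.IsPeriodicPt, Function.IsFixedPt, Function.IsPeriodicPt, Function.IsFixedPt, hpow,
      f.injective.eq_iff, neg_add_rev, zpow_add, Equiv.Perm.mul_apply, zpow_neg_one,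
      Equiv.Perm.inv_def, π.symm.injective.eq_iff, zpow_neg, Equiv.Perm.inv_eq_iff_eq,
      zpow_natCast, Equiv.Perm.iterate_eq_pow, eq_comm]
  have hlast : (π ^ (Function.minimalPeriod π a : ℤ)) a = a := by
    rw [zpow_natCast, ← Equiv.Perm.iterate_eq_pow]
    exact Function.iterate_minimalPeriod
  rw [Function.periodicOrbit, Function.periodicOrbit, hper, Cycle.reverse_coe, Cycle.map_coe]
  congr 1
  refine List.ext_getElem (by simp) fun i h1 h2 => ?_
  have hi : i < Function.minimalPeriod π a := by simpa using h1
  simp only [List.getElem_map, List.getElem_range, List.getElem_reverse, List.length_map,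
    List.length_range, hpow]
  congr 1
  nth_rewrite 1 [← hlast]
  rw [← Equiv.Perm.mul_apply, ← zpow_add, Equiv.Perm.iterate_eq_pow, ← zpow_natCast]
  congr 2
  omega

namespace MultiDigraph

variable {V E : Type*} {H : MultiDigraph V E}

/-! ### Darts and connectivity -/

@[simp] theorem opp_opp (d : E × Bool) : opp (opp d) = d := opp.left_inv d

@[simp] theorem opp_mk (e : E) (b : Bool) : opp (e, b) = (e, !b) := rfl

@[simp] theorem base_true (H : MultiDigraph V E) (e : E) : H.base (e, true) = H.tail e := rfl

@[simp] theorem base_false (H : MultiDigraph V E) (e : E) : H.base (e, false) = H.head e := rfl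

theorem IsConnected.of_forall_edge (hc : H.IsConnected) {P : V → Prop}
    (hP : ∀ e, P (H.tail e) ↔ P (H.head e)) {u : V} (hu : P u) (v : V) : P v := by
  obtain ⟨w⟩ := hc.preconnected u v
  induction w with
  | nil => exact hu
  | cons h _ ih =>
    refine ih ?_
    rw [SimpleGraph.fromRel_adj] at h
    obtain ⟨-, ⟨e, rfl, rfl⟩ | ⟨e, rfl, rfl⟩⟩ := h
    · exact (hP e).1 hu
    · exact (hP e).2 hu

theorem IsConnected.eq_of_forall_edge {α : Type*} (hc : H.IsConnected) {f : V → α}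
    (hf : ∀ e, f (H.tail e) = f (H.head e)) (u v : V) : f u = f v :=
  hc.of_forall_edge (P := fun w => f u = f w) (fun e => by rw [hf]) rfl v

/-! ### Faces and cuts -/

/-- The edge cut of a set `X` of vertices: the edges with exactly one end in `X`. -/
def cut (H : MultiDigraph V E) (X : Set V) : Set E := {e | ¬(H.tail e ∈ X ↔ H.head e ∈ X)}

theorem mem_cut {X : Set V} {e : E} : e ∈ H.cut X ↔ ¬(H.tail e ∈ X ↔ H.head e ∈ X) := Iff.rfl

/-- The coboundary of a function on the vertices, modulo two. The coboundary of the indicator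
function of a set is the indicator function of its edge cut. -/
def coboundary (H : MultiDigraph V E) : (V → ZMod 2) →ₗ[ZMod 2] (E → ZMod 2) :=
  LinearMap.funLeft (ZMod 2) (ZMod 2) H.tail + LinearMap.funLeft (ZMod 2) (ZMod 2) H.head

@[simp] theorem coboundary_apply (f : V → ZMod 2) (e : E) :
    H.coboundary f e = f (H.tail e) + f (H.head e) := rfl

/-- The sum of a function on darts over the two halves of each edge, modulo two. -/
def edgeSum (E : Type*) : (E × Bool → ZMod 2) →ₗ[ZMod 2] (E → ZMod 2) :=
  LinearMap.funLeft (ZMod 2) (ZMod 2) (fun e => (e, true)) +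
    LinearMap.funLeft (ZMod 2) (ZMod 2) (fun e => (e, false))

@[simp] theorem edgeSum_apply (g : E × Bool → ZMod 2) (e : E) :
    edgeSum E g e = g (e, true) + g (e, false) := rfl

theorem sum_darts {M : Type*} [AddCommMonoid M] [Fintype E] (h : E × Bool → M) :
    ∑ d, h d = ∑ e, (h (e, true) + h (e, false)) := by
  rw [Fintype.sum_prod_type]
  simp

theorem finrank_range_coboundary [Fintype V] (hc : H.IsConnected) :
    Fintype.card V ≤ Module.finrank (ZMod 2) (LinearMap.range H.coboundary) + 1 := by
  have h := H.coboundary.finrank_range_add_finrank_ker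
  have hk : Module.finrank (ZMod 2) (LinearMap.ker H.coboundary) ≤ 1 := by
    refine finrank_le_one_of_subset_constants _ fun f hf => hc.eq_of_forall_edge fun e => ?_
    have := congrFun (LinearMap.mem_ker.1 hf) e
    rw [coboundary_apply, Pi.zero_apply, CharTwo.add_eq_zero] at this
    exact this
  rw [Module.finrank_fintype_fun_eq_card] at h
  omega

namespace RotationSystem

theorem facePerm_apply (φ : H.RotationSystem) (d : E × Bool) :
    φ.facePerm d = φ.rot (opp d) := rfl

theorem base_facePerm (φ : H.RotationSystem) (d : E × Bool) :
    H.base (φ.facePerm d) = H.base (opp d) := φ.base_rot _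

theorem base_rot_symm (φ : H.RotationSystem) (d : E × Bool) :
    H.base (φ.rot.symm d) = H.base d := by
  rw [← φ.base_rot, Equiv.apply_symm_apply]

/-- The functions on darts, modulo two, that are constant on every face. -/
def faceFunctions (φ : H.RotationSystem) : Submodule (ZMod 2) (E × Bool → ZMod 2) where
  carrier := {g | ∀ d, g (φ.facePerm d) = g d}
  add_mem' hf hg d := congrArg₂ (· + ·) (hf d) (hg d)
  zero_mem' _ := rfl
  smul_mem' c _ hg d := congrArg (c • ·) (hg d)

/-- The subspace of the edge space that is spanned by the faces, where a face stands for the set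
of edges that occur an odd number of times in its boundary walk. -/
def faceSpace (φ : H.RotationSystem) : Submodule (ZMod 2) (E → ZMod 2) :=
  φ.faceFunctions.map (edgeSum E)

instance [Finite E] (φ : H.RotationSystem) : Finite φ.Face :=
  inferInstanceAs (Finite (Quotient _))

theorem finrank_faceFunctions [Finite E] (φ : H.RotationSystem) :
    Module.finrank (ZMod 2) φ.faceFunctions = Nat.card φ.Face := by
  have := Fintype.ofFinite φ.Face
  have e : φ.faceFunctions ≃ₗ[ZMod 2] (φ.Face → ZMod 2) :=
    { toFun := fun g => Quotient.lift g.1 fun _ _ h => h.map_eq g.2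
      invFun := fun f => ⟨fun d => f (Quotient.mk (Equiv.Perm.SameCycle.setoid φ.facePerm) d),
        fun d => congrArg f (Quotient.sound (Equiv.Perm.sameCycle_apply_left.2 .rfl))⟩
      map_add' := fun f g => funext fun F => Quotient.inductionOn F fun _ => rfl
      map_smul' := fun c g => funext fun F => Quotient.inductionOn F fun _ => rfl
      left_inv := fun g => rfl
      right_inv := fun f => funext fun F => Quotient.inductionOn F fun _ => rfl }
  rw [e.finrank_eq, Module.finrank_fintype_fun_eq_card, Nat.card_eq_fintype_card]

/-- The only relation between the faces is that the sum of all of them vanishes: the dual of a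
connected graph is connected. -/
theorem card_face_le_finrank_faceSpace [Finite E] (φ : H.RotationSystem) (hc : H.IsConnected) :
    Nat.card φ.Face ≤ Module.finrank (ZMod 2) φ.faceSpace + 1 := by
  have := Fintype.ofFinite E
  have h := ((edgeSum E).domRestrict φ.faceFunctions).finrank_range_add_finrank_ker
  rw [LinearMap.range_domRestrict, φ.finrank_faceFunctions] at h
  have hk : Module.finrank (ZMod 2)
      (LinearMap.ker ((edgeSum E).domRestrict φ.faceFunctions)) ≤ 1 := by
    rw [(Submodule.equivMapOfInjective _ φ.faceFunctions.injective_subtype _).finrank_eq]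
    refine finrank_le_one_of_subset_constants _ ?_
    rintro _ ⟨⟨g, hg⟩, hk, rfl⟩ d d'
    have hopp (e : E) : g (e, true) = g (e, false) := by
      have := congrFun (LinearMap.mem_ker.1 hk) e
      exact CharTwo.add_eq_zero.1 this
    have hrot (a : E × Bool) : g (φ.rot a) = g a := by
      have := hg (opp a)
      rw [facePerm_apply, opp_opp] at this
      obtain ⟨e, _ | _⟩ := a
      · exact this.trans (hopp e)
      · exact this.trans (hopp e).symm
    have hconst : ∀ a, H.base a = H.base d' → g d = g a := by
      refine hc.of_forall_edge (P := fun v => ∀ a, H.base a = v → g d = g a) (fun e => ?_)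
        (u := H.base d) (fun a ha => (φ.sameCycle_rot d a ha.symm).map_eq hrot) _
      constructor
      · intro h a ha
        exact ((h (e, true) rfl).trans (hopp e)).trans
          ((φ.sameCycle_rot (e, false) a ha.symm).map_eq hrot)
      · intro h a ha
        exact ((h (e, false) rfl).trans (hopp e).symm).trans
          ((φ.sameCycle_rot (e, true) a ha.symm).map_eq hrot)
    exact hconst d' rfl
  change Nat.card φ.Face ≤ Module.finrank (ZMod 2) (φ.faceFunctions.map (edgeSum E)) + 1
  omega

/-- If a function on darts does not change along faces where these turn at a vertex of `T`, then
its sum over all halves of edges in the cut of `T` vanishes modulo two: the darts that enter `T`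
and the darts that leave it have the same sum. -/
theorem sum_cut_eq_zero [Fintype E] (φ : H.RotationSystem) (T : Set V)
    [DecidablePred (· ∈ H.cut T)] {h : E × Bool → ZMod 2}
    (hh : ∀ d, H.base (opp d) ∈ T → h (φ.facePerm d) = h d) :
    ∑ e with e ∈ H.cut T, (h (e, true) + h (e, false)) = 0 := by
  classical
  have key : ∑ d, (if H.base (opp d) ∈ T then h d else 0) =
      ∑ d, (if H.base d ∈ T then h d else 0) := by
    rw [← Equiv.sum_comp φ.facePerm fun d => if H.base d ∈ T then h d else 0]
    refine Finset.sum_congr rfl fun d _ => ?_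
    rw [base_facePerm]
    split_ifs with hd
    · exact (hh d hd).symm
    · rfl
  rw [← CharTwo.add_eq_zero, ← Finset.sum_add_distrib, sum_darts] at key
  rw [Finset.sum_filter]
  refine Eq.trans ?_ key
  refine Finset.sum_congr rfl fun e _ => ?_
  simp only [opp_mk, Bool.not_true, Bool.not_false, base_true, base_false, mem_cut]
  have h2 (a : ZMod 2) : a + a = 0 := CharTwo.add_self_eq_zero a
  by_cases h1 : H.tail e ∈ T <;> by_cases h3 : H.head e ∈ T <;> simp [h1, h3, h2]

/-- Every face meets every edge cut evenly. -/
theorem range_coboundary_le [Fintype E] (φ : H.RotationSystem) :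
    LinearMap.range H.coboundary ≤ dotPerp φ.faceSpace := by
  rintro _ ⟨f, rfl⟩ _ ⟨g, hg, rfl⟩
  have key : ∑ d, g d * f (H.base (opp d)) = ∑ d, g d * f (H.base d) := by
    rw [← Equiv.sum_comp φ.facePerm (fun d => g d * f (H.base d))]
    exact Finset.sum_congr rfl fun d _ => by rw [base_facePerm, hg d]
  rw [← CharTwo.add_eq_zero, ← Finset.sum_add_distrib, sum_darts] at key
  rw [← key]
  refine Finset.sum_congr rfl fun e _ => ?_
  simp only [edgeSum_apply, coboundary_apply, opp_mk, Bool.not_true, Bool.not_false, base_true,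
    base_false]
  ring

/-- The Euler characteristic of a connected surface is at most two. -/
theorem card_face_le [Fintype V] [Fintype E] (φ : H.RotationSystem) (hc : H.IsConnected) :
    Nat.card φ.Face + Fintype.card V ≤ Fintype.card E + 2 := by
  have h1 := finrank_add_finrank_dotPerp φ.faceSpace
  have h2 := Submodule.finrank_mono φ.range_coboundary_le
  have h3 := finrank_range_coboundary hc
  have h4 := φ.card_face_le_finrank_faceSpace hc
  omega

/-- In the sphere, a set of edges that meets every face evenly is an edge cut. -/
theorem dotPerp_faceSpace [Fintype V] [Fintype E] (φ : H.RotationSystem) (hc : H.IsConnected)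
    (hφ : φ.eulerChar = 2) : dotPerp φ.faceSpace = LinearMap.range H.coboundary := by
  refine (Submodule.eq_of_le_of_finrank_le φ.range_coboundary_le ?_).symm
  have h1 := finrank_add_finrank_dotPerp φ.faceSpace
  have h3 := finrank_range_coboundary hc
  have h4 := φ.card_face_le_finrank_faceSpace hc
  rw [eulerChar, Nat.card_eq_fintype_card, Nat.card_eq_fintype_card] at hφ
  omega

end RotationSystem

/-! ### Reversal of the rotation on a set of vertices -/

namespace RotationSystem

/-- The rotation of `ψ` is the reverse of that of `φ` at every vertex of `S`, and the same at
every other vertex. -/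
def ReversedOn (φ ψ : H.RotationSystem) (S : Set V) : Prop :=
  ∀ d : E × Bool, (H.base d ∈ S → ψ.rot d = φ.rot.symm d) ∧ (H.base d ∉ S → ψ.rot d = φ.rot d)

theorem ReversedOn.symm {φ ψ : H.RotationSystem} {S : Set V} (h : φ.ReversedOn ψ S) :
    ψ.ReversedOn φ S := by
  refine fun d => ⟨fun hd => ?_, fun hd => ((h d).2 hd).symm⟩
  rw [Equiv.eq_symm_apply, (h _).1 (by rwa [φ.base_rot]), Equiv.symm_apply_apply]

theorem ReversedOn.rot_symm_of_mem {φ ψ : H.RotationSystem} {S : Set V} (h : φ.ReversedOn ψ S)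
    {d : E × Bool} (hd : H.base d ∈ S) : ψ.rot.symm d = φ.rot d :=
  ((h.symm d).1 hd).symm

theorem ReversedOn.rot_symm_of_notMem {φ ψ : H.RotationSystem} {S : Set V}
    (h : φ.ReversedOn ψ S) {d : E × Bool} (hd : H.base d ∉ S) :
    ψ.rot.symm d = φ.rot.symm d := by
  rw [Equiv.symm_apply_eq, (h _).2 (by rwa [base_rot_symm]), Equiv.apply_symm_apply]

theorem ReversedOn.symmDiff {φ ψ χ : H.RotationSystem} {S X : Set V} (h : φ.ReversedOn ψ S)
    (hX : φ.ReversedOn χ X) : χ.ReversedOn ψ (symmDiff S X) := by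
  intro d
  rw [Set.mem_symmDiff]
  by_cases hs : H.base d ∈ S <;> by_cases hx : H.base d ∈ X <;>
    simp only [hs, hx, not_true, not_false_eq_true, and_false, and_true, or_false, false_or,
      true_implies, false_implies, true_and]
  · rw [(h d).1 hs, (hX d).1 hx]
  · rw [(h d).1 hs, hX.rot_symm_of_notMem hx]
  · rw [(h d).2 hs, hX.rot_symm_of_mem hx]
  · rw [(h d).2 hs, (hX d).2 hx]

theorem ReversedOn.facePerm_of_notMem {φ ψ : H.RotationSystem} {S : Set V}
    (h : φ.ReversedOn ψ S) {d : E × Bool} (hd : H.base (opp d) ∉ S) :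
    ψ.facePerm d = φ.facePerm d := (h _).2 hd

theorem ReversedOn.facePerm_opp_facePerm {φ ψ : H.RotationSystem} {S : Set V}
    (h : φ.ReversedOn ψ S) {d : E × Bool} (hd : H.base (opp d) ∈ S) :
    ψ.facePerm (opp (φ.facePerm d)) = opp d := by
  rw [facePerm_apply, opp_opp, facePerm_apply, (h _).1 (by rwa [φ.base_rot]),
    Equiv.symm_apply_apply]

/-- If two embeddings are reverses of each other on `S` and agree elsewhere, then each face of the
one meets each face of the other in an even number of edges of the cut of `S`. The two faces run
along each other in the same direction outside `S` and in opposite directions inside `S`. -/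
theorem ReversedOn.sum_cut_edgeSum_mul [Fintype E] {φ ψ : H.RotationSystem} {S : Set V}
    [DecidablePred (· ∈ H.cut S)] (h : φ.ReversedOn ψ S) {g g' : E × Bool → ZMod 2}
    (hg : g ∈ φ.faceFunctions) (hg' : g' ∈ ψ.faceFunctions) :
    ∑ e with e ∈ H.cut S, edgeSum E g e * edgeSum E g' e = 0 := by
  classical
  have h1 := φ.sum_cut_eq_zero Sᶜ (h := fun d => g d * g' d) fun d hd => by
    have hd' : H.base (opp d) ∉ S := hd
    rw [hg d, ← h.facePerm_of_notMem hd', hg' d]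
  have h2 := φ.sum_cut_eq_zero S (h := fun d => g d * g' (opp d)) fun d hd => by
    rw [hg d, ← h.facePerm_opp_facePerm hd, hg']
  have hcut : H.cut Sᶜ = H.cut S := by
    ext e
    simp only [mem_cut, Set.mem_compl_iff, not_iff_not]
  simp only [hcut] at h1
  rw [← add_zero (0 : ZMod 2)]
  nth_rewrite 1 [← h1]
  rw [← h2, ← Finset.sum_add_distrib]
  refine Finset.sum_congr rfl fun e _ => ?_
  simp only [edgeSum_apply, opp_mk, Bool.not_true, Bool.not_false]
  ring

end RotationSystem

/-! ### Cuts with two edges -/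

/-- Two vertices are related if they are joined by an edge that is not in `D`. The quotient by
the equivalence relation that this generates is the set of components of the graph without `D`. -/
def JoinedOff (H : MultiDigraph V E) (D : Set E) (u v : V) : Prop :=
  ∃ e, e ∉ D ∧ H.tail e = u ∧ H.head e = v

namespace RotationSystem

/-- In the sphere, if `S` is reversed between two embeddings, then deleting the cut of `S` leaves
more than half as many components as the cut has edges. The reason is that the restrictions of
the two face spaces to the cut are orthogonal to each other, while the orthogonal complement of
each of them consists of cuts. -/
theorem ReversedOn.card_cut_le [Fintype V] [Fintype E] (hc : H.IsConnected)
    {φ ψ : H.RotationSystem} (hφ : φ.eulerChar = 2) (hψ : ψ.eulerChar = 2) {S : Set V}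
    (h : φ.ReversedOn ψ S) :
    (H.cut S).ncard + 2 ≤ 2 * Nat.card (Quot (H.JoinedOff (H.cut S))) := by
  classical
  set D := H.cut S with hD
  have : Fintype (Quot (H.JoinedOff D)) := Fintype.ofFinite _
  obtain ⟨v₀⟩ := hc.nonempty
  let res : (E → ZMod 2) →ₗ[ZMod 2] (D → ZMod 2) :=
    LinearMap.funLeft (ZMod 2) (ZMod 2) Subtype.val
  -- The range of `κ` consists of the cuts contained in `D`, and constants are in its kernel.
  let κ : (Quot (H.JoinedOff D) → ZMod 2) →ₗ[ZMod 2] (D → ZMod 2) :=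
    res ∘ₗ H.coboundary ∘ₗ LinearMap.funLeft (ZMod 2) (ZMod 2) (Quot.mk _)
  have perp_le (χ : H.RotationSystem) (hχ : χ.eulerChar = 2) :
      dotPerp (χ.faceSpace.map res) ≤ LinearMap.range κ := by
    intro x hx
    -- Extended by zero, `x` is a coboundary, of a function that is constant on components.
    let y : E → ZMod 2 := fun e => if he : e ∈ D then x ⟨e, he⟩ else 0
    have hy : y ∈ dotPerp χ.faceSpace := by
      intro w hw
      rw [← hx (res w) (Submodule.mem_map_of_mem hw)]
      simp only [dotProduct]
      rw [← Finset.sum_subset (Finset.subset_univ (Finset.univ.filter (· ∈ D))) fun e _ he => by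
        rw [show y e = 0 from dif_neg (by simpa using he), mul_zero]]
      rw [Finset.sum_subtype (p := (· ∈ D)) _ (by simp)]
      exact Finset.sum_congr rfl fun e _ => congrArg (w e * ·) (dif_pos e.2)
    rw [χ.dotPerp_faceSpace hc hχ] at hy
    obtain ⟨f, hf⟩ := hy
    refine ⟨Quot.lift f ?_, funext fun e => ?_⟩
    · rintro _ _ ⟨e, he, rfl, rfl⟩
      have := congrFun hf e
      rw [coboundary_apply] at this
      exact CharTwo.add_eq_zero.1 (this.trans (dif_neg he))
    · exact (congrFun hf e).trans (dif_pos e.2)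
  have perp : φ.faceSpace.map res ≤ dotPerp (ψ.faceSpace.map res) := by
    rintro _ ⟨_, ⟨g, hg, rfl⟩, rfl⟩ _ ⟨_, ⟨g', hg', rfl⟩, rfl⟩
    rw [dotProduct_comm, ← h.sum_cut_edgeSum_mul hg hg',
      Finset.sum_subtype (p := (· ∈ D)) _ (by simp [hD])]
    rfl
  have h1 := finrank_add_finrank_dotPerp (φ.faceSpace.map res)
  have h2 := Submodule.finrank_mono (perp_le φ hφ)
  have h3 := Submodule.finrank_mono (perp.trans (perp_le ψ hψ))
  have h4 := κ.finrank_range_add_finrank_ker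
  have h5 : 0 < Module.finrank (ZMod 2) (LinearMap.ker κ) := by
    rw [Module.finrank_pos_iff_exists_ne_zero]
    refine ⟨⟨fun _ => 1, ?_⟩, fun h0 => one_ne_zero (α := ZMod 2)
      (congrFun (congrArg Subtype.val h0) (Quot.mk _ v₀))⟩
    exact LinearMap.mem_ker.2 (funext fun e => CharTwo.add_self_eq_zero (1 : ZMod 2))
  rw [Module.finrank_fintype_fun_eq_card] at h4
  rw [Nat.card_eq_fintype_card, ← Nat.card_coe_set_eq, Nat.card_eq_fintype_card]
  omega

end RotationSystem

/-- As many edges leave a set of vertices as enter it. -/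
theorem IsTwoRegular.card_leaving_eq_card_entering [Fintype V] [Fintype E] (hr : H.IsTwoRegular)
    (X : Set V) :
    {e | H.tail e ∈ X ∧ H.head e ∉ X}.ncard = {e | H.tail e ∉ X ∧ H.head e ∈ X}.ncard := by
  classical
  have count (f : E → V) (hf : ∀ v, {e | f e = v}.ncard = 2) :
      {e | f e ∈ X}.ncard = 2 * X.ncard := by
    simp only [Set.ncard_eq_toFinset_card'] at hf ⊢
    rw [Finset.card_eq_sum_card_fiberwise (f := f) (t := X.toFinset)
      (fun e he => by simpa using he), mul_comm, ← smul_eq_mul, ← Finset.sum_const]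
    refine Finset.sum_congr rfl fun v hv => ?_
    rw [← hf v]
    congr 1
    ext e
    simp only [Finset.mem_filter, Set.mem_toFinset, Set.mem_ofPred_eq, and_iff_right_iff_imp]
    rintro rfl
    simpa using hv
  have ht := count H.tail fun v => (hr v).2
  have hh := count H.head fun v => (hr v).1
  have h1 := Set.ncard_inter_add_ncard_sdiff_eq_ncard {e | H.tail e ∈ X} {e | H.head e ∈ X}
  have h2 := Set.ncard_inter_add_ncard_sdiff_eq_ncard {e | H.head e ∈ X} {e | H.tail e ∈ X}
  rw [Set.inter_comm] at h2
  have e1 : {e | H.tail e ∈ X ∧ H.head e ∉ X} = {e | H.tail e ∈ X} \ {e | H.head e ∈ X} := rfl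
  have e2 : {e | H.tail e ∉ X ∧ H.head e ∈ X} = {e | H.head e ∈ X} \ {e | H.tail e ∈ X} := by
    ext e; exact and_comm
  rw [e1, e2]
  omega

/-- A set `X` of vertices whose cut consists of one edge `x` that leaves it and one edge `y` that
enters it. -/
structure IsTwoEdgeCut (H : MultiDigraph V E) (X : Set V) (x y : E) : Prop where
  tail_x : H.tail x ∈ X
  head_x : H.head x ∉ X
  head_y : H.head y ∈ X
  tail_y : H.tail y ∉ X
  tail_mem_iff : ∀ e, e ≠ x → e ≠ y → (H.tail e ∈ X ↔ H.head e ∈ X)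

theorem IsTwoEdgeCut.ne {X : Set V} {x y : E} (h : H.IsTwoEdgeCut X x y) : x ≠ y := by
  rintro rfl
  exact h.tail_y h.tail_x

theorem IsTwoEdgeCut.cut_eq {X : Set V} {x y : E} (h : H.IsTwoEdgeCut X x y) :
    H.cut X = {x, y} := by
  ext e
  rw [mem_cut, Set.mem_insert_iff, Set.mem_singleton_iff]
  constructor
  · intro he
    by_contra! hne
    exact he (h.tail_mem_iff e hne.1 hne.2)
  · rintro (rfl | rfl)
    · simp [h.tail_x, h.head_x]
    · simp [h.tail_y, h.head_y]

theorem IsTwoRegular.exists_isTwoEdgeCut [Fintype V] [Fintype E] (hr : H.IsTwoRegular)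
    {X : Set V} (h0 : (H.cut X).Nonempty) (h4 : (H.cut X).ncard < 4) :
    ∃ x y, H.IsTwoEdgeCut X x y := by
  have heq := hr.card_leaving_eq_card_entering X
  have hun : H.cut X = {e | H.tail e ∈ X ∧ H.head e ∉ X} ∪ {e | H.tail e ∉ X ∧ H.head e ∈ X} := by
    ext e
    simp only [mem_cut, Set.mem_union, Set.mem_ofPred_eq]
    tauto
  have hdisj : Disjoint {e | H.tail e ∈ X ∧ H.head e ∉ X} {e | H.tail e ∉ X ∧ H.head e ∈ X} :=
    Set.disjoint_left.2 fun e h h' => h'.1 h.1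
  have hpos := (Set.ncard_pos (Set.toFinite _)).2 h0
  have hcard := Set.ncard_union_eq hdisj (Set.toFinite _) (Set.toFinite _)
  rw [← hun] at hcard
  obtain ⟨x, hx⟩ := Set.ncard_eq_one.1
    (show {e | H.tail e ∈ X ∧ H.head e ∉ X}.ncard = 1 by omega)
  obtain ⟨y, hy⟩ := Set.ncard_eq_one.1
    (show {e | H.tail e ∉ X ∧ H.head e ∈ X}.ncard = 1 by omega)
  have hx' : x ∈ {e | H.tail e ∈ X ∧ H.head e ∉ X} := hx ▸ rfl
  have hy' : y ∈ {e | H.tail e ∉ X ∧ H.head e ∈ X} := hy ▸ rfl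
  refine ⟨x, y, hx'.1, hx'.2, hy'.2, hy'.1, fun e hex hey => ?_⟩
  have h1 : e ∉ {e | H.tail e ∈ X ∧ H.head e ∉ X} := hx ▸ hex
  have h2 : e ∉ {e | H.tail e ∉ X ∧ H.head e ∈ X} := hy ▸ hey
  simp only [Set.mem_ofPred_eq] at h1 h2
  tauto

/-- If two embeddings in the sphere are reverses of each other on `S` and agree elsewhere, then
the cut of `S`, unless it is empty, contains a cut with two edges. It is the cut of a component of
the graph without the cut of `S`; the average number of edges of these cuts is below four. -/
theorem RotationSystem.ReversedOn.exists_isTwoEdgeCut [Fintype V] [Fintype E]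
    (hc : H.IsConnected) (hr : H.IsTwoRegular) {φ ψ : H.RotationSystem} (hφ : φ.eulerChar = 2)
    (hψ : ψ.eulerChar = 2) {S : Set V} (h : φ.ReversedOn ψ S) (hS : (H.cut S).Nonempty) :
    ∃ X x y, H.IsTwoEdgeCut X x y ∧ H.cut X ⊆ H.cut S := by
  classical
  have hle := h.card_cut_le hc hφ hψ
  set D := H.cut S with hD
  have : Fintype (Quot (H.JoinedOff D)) := Fintype.ofFinite _
  let X (C : Quot (H.JoinedOff D)) : Set V := {v | Quot.mk _ v = C}
  have hsub (C) : H.cut (X C) ⊆ D := by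
    intro e he
    by_contra heD
    have : Quot.mk (H.JoinedOff D) (H.tail e) = Quot.mk _ (H.head e) :=
      Quot.sound ⟨e, heD, rfl, rfl⟩
    exact he (by simp only [X, Set.mem_ofPred_eq, this])
  have hne (C) : (H.cut (X C)).Nonempty := by
    by_contra hempty
    rw [Set.not_nonempty_iff_eq_empty] at hempty
    obtain ⟨v, rfl⟩ := Quot.exists_rep C
    -- a component with an empty cut is everything, but the ends of an edge of `D` are separated
    have hall : ∀ u, u ∈ X (Quot.mk _ v) := hc.of_forall_edge (u := v)
      (fun e => by
        by_contra hne
        exact Set.notMem_empty e (hempty ▸ hne)) rfl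
    obtain ⟨e, he⟩ := hS
    have hlift : ∀ u w, H.JoinedOff D u w → (u ∈ S) = (w ∈ S) := by
      rintro _ _ ⟨e, he, rfl, rfl⟩
      rw [hD, mem_cut, not_not] at he
      exact propext he
    have heq : Quot.mk (H.JoinedOff D) (H.tail e) = Quot.mk _ (H.head e) :=
      (hall _).trans (hall _).symm
    exact he (iff_of_eq (congrArg (Quot.lift (· ∈ S) hlift) heq))
  obtain ⟨C, hC⟩ : ∃ C, (H.cut (X C)).ncard < 4 := by
    by_contra! hall
    have h1 : ∑ C, 4 ≤ ∑ C, (H.cut (X C)).ncard := Finset.sum_le_sum fun C _ => hall C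
    have h2 : ∑ C, (H.cut (X C)).ncard ≤ 2 * D.ncard := by
      -- An edge in the cut of a component has its tail or its head there.
      have fib (f : E → V) :
          D.ncard = ∑ C, {e ∈ D | Quot.mk (H.JoinedOff D) (f e) = C}.ncard := by
        rw [Set.ncard_eq_toFinset_card', Finset.card_eq_sum_card_fiberwise
          (f := fun e => Quot.mk (H.JoinedOff D) (f e)) (t := Finset.univ) (by simp)]
        refine Finset.sum_congr rfl fun C _ => ?_
        rw [Set.ncard_eq_toFinset_card']
        congr 1
        ext e
        simp
      rw [two_mul]
      nth_rewrite 2 [fib H.tail]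
      nth_rewrite 1 [fib H.head]
      rw [← Finset.sum_add_distrib]
      refine Finset.sum_le_sum fun C _ =>
        (Set.ncard_le_ncard ?_ (Set.toFinite _)).trans (Set.ncard_union_le _ _)
      intro e he
      have heD := hsub C he
      rw [mem_cut] at he
      by_cases ht : H.tail e ∈ X C
      · exact Or.inr ⟨heD, ht⟩
      · exact Or.inl ⟨heD, by by_contra hh; exact he (iff_of_false ht hh)⟩
    rw [Finset.sum_const, Finset.card_univ, smul_eq_mul, ← Nat.card_eq_fintype_card] at h1
    omega
  obtain ⟨x, y, hxy⟩ := hr.exists_isTwoEdgeCut (hne C) hC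
  exact ⟨X C, x, y, hxy, hsub C⟩

/-! ### Directed faces -/

theorem IsTwoRegular.ncard_darts (hr : H.IsTwoRegular) (v : V) (b : Bool) :
    {e | H.base (e, b) = v}.ncard = 2 := by
  cases b
  · exact (hr v).1
  · exact (hr v).2

theorem IsTwoRegular.exists_ne (hr : H.IsTwoRegular) (d : E × Bool) :
    ∃ d', d' ≠ d ∧ H.base d' = H.base d ∧ d'.2 = d.2 := by
  obtain ⟨e, b⟩ := d
  have h := hr.ncard_darts (H.base (e, b)) b
  obtain ⟨e', he', hne⟩ := Set.exists_ne_of_one_lt_ncard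
    (show 1 < {e' | H.base (e', b) = H.base (e, b)}.ncard by omega) e
  exact ⟨(e', b), fun h => hne (congrArg Prod.fst h), he', rfl⟩

theorem IsTwoRegular.eq_or_eq (hr : H.IsTwoRegular) {a b c : E × Bool}
    (hab : a ≠ b) (hba : H.base b = H.base a) (hca : H.base c = H.base a) (hb : b.2 = a.2)
    (hc : c.2 = a.2) : c = a ∨ c = b := by
  obtain ⟨a, s⟩ := a
  obtain ⟨b, t⟩ := b
  obtain ⟨c, u⟩ := c
  obtain rfl : t = s := hb
  obtain rfl : u = t := hc
  have h := hr.ncard_darts (H.base (a, u)) u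
  obtain ⟨p, q, -, hpq⟩ := Set.ncard_eq_two.1 h
  have ha' : a ∈ ({p, q} : Set E) := hpq ▸ rfl
  have hb' : b ∈ ({p, q} : Set E) := hpq ▸ hba
  have hc' : c ∈ ({p, q} : Set E) := hpq ▸ hca
  have hab' : a ≠ b := fun h => hab (by rw [h])
  simp only [Set.mem_insert_iff, Set.mem_singleton_iff] at ha' hb' hc'
  simp only [Prod.mk.injEq, and_true]
  grind

namespace RotationSystem

/-- All faces are directed if and only if the darts at each vertex alternate between out and in. -/
theorem facesDirected_iff {φ : H.RotationSystem} :
    φ.FacesDirected ↔ ∀ d, (φ.rot d).2 = !d.2 := by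
  constructor
  · intro h d
    have := h (opp d) (φ.facePerm (opp d)) (Equiv.Perm.sameCycle_apply_right.2 .rfl)
    rw [facePerm_apply, opp_opp] at this
    exact this.symm
  · intro h d d' hd
    refine hd.map_eq (g := Prod.snd) fun a => ?_
    rw [facePerm_apply, h]
    simp [opp]

theorem FacesDirected.facePerm_snd {φ : H.RotationSystem} (h : φ.FacesDirected) (d : E × Bool) :
    (φ.facePerm d).2 = d.2 :=
  h _ _ (Equiv.Perm.sameCycle_apply_left.2 .rfl)

theorem FacesDirected.rot_symm_snd {φ : H.RotationSystem} (h : φ.FacesDirected) (d : E × Bool) :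
    (φ.rot.symm d).2 = !d.2 := by
  have := facesDirected_iff.1 h (φ.rot.symm d)
  rw [Equiv.apply_symm_apply] at this
  rw [this, Bool.not_not]

theorem FacesDirected.rot_ne_rot_symm [Finite E] (hr : H.IsTwoRegular) {φ : H.RotationSystem}
    (h : φ.FacesDirected) (d : E × Bool) : φ.rot d ≠ φ.rot.symm d := by
  intro heq
  rw [Equiv.eq_symm_apply] at heq
  obtain ⟨d', hne, hbase, hsnd⟩ := hr.exists_ne d
  have : d' = d ∨ d' = φ.rot d := by
    refine (φ.sameCycle_rot d d' hbase.symm).induction_on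
      (P := fun c => c = d ∨ c = φ.rot d) (Or.inl rfl) ?_
    rintro c (rfl | rfl)
    · exact Or.inr rfl
    · exact Or.inl heq
  rcases this with rfl | rfl
  · exact hne rfl
  · rw [facesDirected_iff.1 h] at hsnd
    simp at hsnd

/-- There are only two cyclic orders of the four darts at a vertex that alternate between out and
in, and these are the reverses of each other. -/
theorem FacesDirected.exists_reversedOn [Finite E] (hr : H.IsTwoRegular) {φ ψ : H.RotationSystem}
    (hφ : φ.FacesDirected) (hψ : ψ.FacesDirected) : ∃ S, φ.ReversedOn ψ S := by
  have hor (d : E × Bool) : ψ.rot d = φ.rot d ∨ ψ.rot d = φ.rot.symm d := by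
    refine hr.eq_or_eq (hφ.rot_ne_rot_symm hr d) ?_ ?_ ?_ ?_
    · rw [base_rot_symm, φ.base_rot]
    · rw [ψ.base_rot, φ.base_rot]
    · rw [hφ.rot_symm_snd, facesDirected_iff.1 hφ]
    · rw [facesDirected_iff.1 hψ, facesDirected_iff.1 hφ]
  refine ⟨{v | ∀ d, H.base d = v → ψ.rot d = φ.rot.symm d}, fun d => ⟨fun hd => hd d rfl, ?_⟩⟩
  intro hd
  simp only [Set.mem_ofPred_eq, not_forall] at hd
  obtain ⟨d₀, hbase, hne⟩ := hd
  refine (φ.sameCycle_rot d₀ d hbase).induction_on (P := fun c => ψ.rot c = φ.rot c)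
    ((hor d₀).resolve_right hne) ?_
  intro c hc
  refine (hor (φ.rot c)).resolve_right fun hc' => ?_
  rw [Equiv.symm_apply_apply] at hc'
  -- otherwise `ψ.rot` has order two at `c`
  refine hψ.rot_ne_rot_symm hr c ?_
  rw [Equiv.eq_symm_apply, hc, hc']

/-! ### Flipping a cut with two edges -/

open Classical in
/-- The rotation system in which the rotation is reversed at the vertices of `X`. -/
noncomputable def reflect [Finite E] (φ : H.RotationSystem) (X : Set V) : H.RotationSystem where
  rot :=
    { toFun := fun d => if H.base d ∈ X then φ.rot.symm d else φ.rot d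
      invFun := fun d => if H.base d ∈ X then φ.rot d else φ.rot.symm d
      left_inv := fun d => by
        by_cases h : H.base d ∈ X <;> simp [h, φ.base_rot, φ.base_rot_symm]
      right_inv := fun d => by
        by_cases h : H.base d ∈ X <;> simp [h, φ.base_rot, φ.base_rot_symm] }
  base_rot d := by
    by_cases h : H.base d ∈ X <;> simp [h, φ.base_rot, φ.base_rot_symm]
  sameCycle_rot d d' hd := by
    have hcycle := φ.sameCycle_rot d d' hd
    by_cases h : H.base d ∈ X
    · refine ((Equiv.Perm.sameCycle_inv.2 hcycle).induction_on
        (P := fun c => H.base c = H.base d ∧ Equiv.Perm.SameCycle _ d c) ⟨rfl, .rfl⟩ ?_).2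
      rintro c ⟨h1, h2⟩
      refine ⟨(φ.base_rot_symm c).trans h1, ?_⟩
      convert! Equiv.Perm.sameCycle_apply_right.2 h2 using 1
      exact (if_pos (h1 ▸ h)).symm
    · refine (hcycle.induction_on
        (P := fun c => H.base c = H.base d ∧ Equiv.Perm.SameCycle _ d c) ⟨rfl, .rfl⟩ ?_).2
      rintro c ⟨h1, h2⟩
      refine ⟨(φ.base_rot c).trans h1, ?_⟩
      convert! Equiv.Perm.sameCycle_apply_right.2 h2 using 1
      exact (if_neg (h1 ▸ h)).symm

theorem reversedOn_reflect [Finite E] (φ : H.RotationSystem) (X : Set V) :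
    φ.ReversedOn (φ.reflect X) X :=
  fun _ => ⟨fun h => if_pos h, fun h => if_neg h⟩

theorem ReversedOn.facesDirected {φ ψ : H.RotationSystem} {S : Set V} (h : φ.ReversedOn ψ S)
    (hφ : φ.FacesDirected) : ψ.FacesDirected := by
  refine facesDirected_iff.2 fun d => ?_
  by_cases hd : H.base d ∈ S
  · rw [(h d).1 hd, hφ.rot_symm_snd]
  · rw [(h d).2 hd, facesDirected_iff.1 hφ]

end RotationSystem

/-- The dart that leaves `X` and is traversed forwards (`true`) or backwards (`false`), where `x`
is the edge that leaves `X` and `y` is the edge that enters it. -/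
def exitDart (x y : E) (b : Bool) : E × Bool := (bif b then x else y, b)

/-- The dart that enters `X` and is traversed forwards (`true`) or backwards (`false`), where `x`
is the edge that leaves `X` and `y` is the edge that enters it. -/
def entryDart (x y : E) (b : Bool) : E × Bool := (bif b then y else x, b)

namespace IsTwoEdgeCut

variable {X : Set V} {x y : E}

theorem eq_exitDart (hX : H.IsTwoEdgeCut X x y) {d : E × Bool} (h1 : H.base d ∈ X)
    (h2 : H.base (opp d) ∉ X) : d = exitDart x y d.2 := by
  obtain ⟨e, b⟩ := d
  have he : e = x ∨ e = y := by
    have : e ∈ H.cut X := by cases b <;> simp_all [mem_cut]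
    rwa [hX.cut_eq] at this
  have := hX.tail_x
  have := hX.tail_y
  have := hX.head_x
  have := hX.head_y
  rcases he with rfl | rfl <;> cases b <;> simp_all [exitDart]

theorem eq_entryDart (hX : H.IsTwoEdgeCut X x y) {d : E × Bool} (h1 : H.base d ∉ X)
    (h2 : H.base (opp d) ∈ X) : d = entryDart x y d.2 := by
  obtain ⟨e, b⟩ := d
  have he : e = x ∨ e = y := by
    have : e ∈ H.cut X := by cases b <;> simp_all [mem_cut]
    rwa [hX.cut_eq] at this
  have := hX.tail_x
  have := hX.tail_y
  have := hX.head_x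
  have := hX.head_y
  rcases he with rfl | rfl <;> cases b <;> simp_all [entryDart]

theorem base_exitDart (hX : H.IsTwoEdgeCut X x y) (b : Bool) : H.base (exitDart x y b) ∈ X := by
  cases b
  · exact hX.head_y
  · exact hX.tail_x

theorem base_opp_exitDart (hX : H.IsTwoEdgeCut X x y) (b : Bool) :
    H.base (opp (exitDart x y b)) ∉ X := by
  cases b
  · exact hX.tail_y
  · exact hX.head_x

/-- A directed face that leaves `X` has to return to `X`, and there is only one edge along which
it can do so. -/
theorem sameCycle_exitDart_entryDart [Finite E] (hX : H.IsTwoEdgeCut X x y)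
    {φ : H.RotationSystem} (hφ : φ.FacesDirected) (b : Bool) :
    φ.facePerm.SameCycle (exitDart x y b) (entryDart x y b) := by
  by_contra hne
  have key : H.base (exitDart x y b) ∉ X ∧ (exitDart x y b).2 = b ∧
      φ.facePerm.SameCycle (exitDart x y b) (exitDart x y b) := by
    refine (Equiv.Perm.sameCycle_apply_left.2 (Equiv.Perm.SameCycle.refl φ.facePerm
      (exitDart x y b))).induction_on (P := fun c => H.base c ∉ X ∧ c.2 = b ∧
        φ.facePerm.SameCycle (exitDart x y b) c)
      ⟨?_, ?_, Equiv.Perm.sameCycle_apply_right.2 .rfl⟩ ?_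
    · rw [φ.base_facePerm]
      exact hX.base_opp_exitDart b
    · exact hφ.facePerm_snd _
    · rintro c ⟨h1, h2, h3⟩
      refine ⟨?_, by rw [hφ.facePerm_snd, h2], Equiv.Perm.sameCycle_apply_right.2 h3⟩
      rw [φ.base_facePerm]
      intro h4
      rw [hX.eq_entryDart h1 h4, h2] at h3
      exact hne h3
  exact key.1 (hX.base_exitDart b)

/-- Let `ψ` arise from `φ` by reversing `X`. Darts that are not inside `X` and are on the same
face of `ψ` are on the same face of `φ`: while the face of `ψ` is inside `X`, it is between the
two darts, one entering and one leaving `X`, that are on the same face of `φ`. -/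
theorem sameCycle_of_not_inside [Finite E] (hX : H.IsTwoEdgeCut X x y) {φ ψ : H.RotationSystem}
    (hφ : φ.FacesDirected) (h : φ.ReversedOn ψ X) {d d' : E × Bool}
    (hd : ¬(H.base d ∈ X ∧ H.base (opp d) ∈ X)) (hd' : ¬(H.base d' ∈ X ∧ H.base (opp d') ∈ X))
    (hdd' : ψ.facePerm.SameCycle d d') : φ.facePerm.SameCycle d d' := by
  have hψ := h.facesDirected hφ
  have key : (H.base (opp d') ∈ X → φ.facePerm.SameCycle d (entryDart x y d'.2)) ∧
      (H.base (opp d') ∉ X → φ.facePerm.SameCycle d d') := by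
    refine hdd'.induction_on (P := fun z =>
      (H.base (opp z) ∈ X → φ.facePerm.SameCycle d (entryDart x y z.2)) ∧
      (H.base (opp z) ∉ X → φ.facePerm.SameCycle d z)) ⟨fun h1 => ?_, fun _ => .rfl⟩ ?_
    · rw [← hX.eq_entryDart (fun h2 => hd ⟨h2, h1⟩) h1]
    · rintro z ⟨h1, h2⟩
      by_cases hz : H.base (opp z) ∈ X
      · have hz' : H.base (ψ.facePerm z) ∈ X := by rwa [ψ.base_facePerm]
        refine ⟨fun _ => by rw [hψ.facePerm_snd]; exact h1 hz, fun h3 => ?_⟩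
        rw [hX.eq_exitDart hz' h3, hψ.facePerm_snd]
        exact (h1 hz).trans (hX.sameCycle_exitDart_entryDart hφ _).symm
      · have hz' : H.base (ψ.facePerm z) ∉ X := by rwa [ψ.base_facePerm]
        have h4 : φ.facePerm.SameCycle d (ψ.facePerm z) := by
          rw [h.facePerm_of_notMem hz]
          exact Equiv.Perm.sameCycle_apply_right.2 (h2 hz)
        exact ⟨fun h3 => by rwa [← hX.eq_entryDart hz' h3], fun _ => h4⟩
  by_cases h1 : H.base (opp d') ∈ X
  · rw [hX.eq_entryDart (fun h2 => hd' ⟨h2, h1⟩) h1]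
    exact key.1 h1
  · exact key.2 h1

end IsTwoEdgeCut

namespace RotationSystem

/-- A face inside a reversed set is traversed in the opposite direction after the reversal. -/
theorem ReversedOn.sameCycle_opp [Finite E] {φ ψ : H.RotationSystem} {X : Set V}
    (h : φ.ReversedOn ψ X) {d c : E × Bool}
    (hd : ∀ a, φ.facePerm.SameCycle d a → H.base (opp a) ∈ X)
    (hc : ψ.facePerm.SameCycle (opp d) c) : φ.facePerm.SameCycle d (opp c) := by
  refine hc.induction_on (P := fun w => φ.facePerm.SameCycle d (opp w))
    (by rw [opp_opp]) fun w hw => ?_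
  have h1 : φ.facePerm.SameCycle d (φ.facePerm.symm (opp w)) :=
    Equiv.Perm.sameCycle_symm_apply_right.2 hw
  have h2 := h.facePerm_opp_facePerm (hd _ h1)
  rw [Equiv.apply_symm_apply, opp_opp] at h2
  rwa [h2, opp_opp]

/-- Reversing a set with a cut of two edges does not decrease the number of faces. -/
theorem ReversedOn.card_face_le [Finite E] {φ ψ : H.RotationSystem} {X : Set V} {x y : E}
    (hX : H.IsTwoEdgeCut X x y) (hφ : φ.FacesDirected) (h : φ.ReversedOn ψ X) :
    Nat.card φ.Face ≤ Nat.card ψ.Face := by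
  classical
  let inside (d : E × Bool) : Prop := H.base d ∈ X ∧ H.base (opp d) ∈ X
  have hrep (F : φ.Face) : ∃ d, Quotient.mk (Equiv.Perm.SameCycle.setoid φ.facePerm) d = F ∧
      (inside d → ∀ a, φ.facePerm.SameCycle d a → inside a) := by
    obtain ⟨d, rfl⟩ := Quotient.exists_rep F
    by_cases hall : ∀ a, φ.facePerm.SameCycle d a → inside a
    · exact ⟨d, rfl, fun _ => hall⟩
    · push Not at hall
      obtain ⟨a, ha, hna⟩ := hall
      exact ⟨a, Quotient.sound ha.symm, fun h => absurd h hna⟩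
  choose rep hmk hin using hrep
  -- A face inside `X` goes to its reverse; any other face goes to the face of `ψ` through one of
  -- its darts that are not inside `X`.
  let m (F : φ.Face) : ψ.Face :=
    Quotient.mk (Equiv.Perm.SameCycle.setoid ψ.facePerm)
      (if inside (rep F) then opp (rep F) else rep F)
  refine Nat.card_le_card_of_injective m fun F G hFG => ?_
  have hFG' := Quotient.exact hFG
  rw [← hmk F, ← hmk G]
  refine Quotient.sound ?_
  change ψ.facePerm.SameCycle _ _ at hFG'
  change φ.facePerm.SameCycle _ _
  by_cases hF : inside (rep F) <;> by_cases hG : inside (rep G)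
  · rw [if_pos hF, if_pos hG] at hFG'
    have := h.sameCycle_opp (fun a ha => (hin F hF a ha).2) hFG'
    rwa [opp_opp] at this
  · rw [if_pos hF, if_neg hG] at hFG'
    have := hin F hF _ (h.sameCycle_opp (fun a ha => (hin F hF a ha).2) hFG')
    exact absurd ⟨by simpa using this.2, this.1⟩ hG
  · rw [if_neg hF, if_pos hG] at hFG'
    have := hin G hG _ (h.sameCycle_opp (fun a ha => (hin G hG a ha).2) hFG'.symm)
    exact absurd ⟨by simpa using this.2, this.1⟩ hF
  · rw [if_neg hF, if_neg hG] at hFG'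
    exact hX.sameCycle_of_not_inside hφ h hF hG hFG'

end RotationSystem

namespace SphereEmbedding

theorem exists_isWhitneyFlip [Fintype V] [Fintype E] (hc : H.IsConnected)
    (φ : H.SphereEmbedding) {X : Set V} {x y : E} (hX : H.IsTwoEdgeCut X x y) :
    ∃ χ : H.SphereEmbedding, φ.IsWhitneyFlip χ ∧
      φ.ReversedOn χ.toRotationSystem X := by
  have hrev := φ.reversedOn_reflect X
  have hle := hrev.card_face_le hX φ.facesDirected
  have hge := (φ.reflect X).card_face_le hc
  have hφ := φ.eulerChar_eq
  have heuler : (φ.reflect X).eulerChar = 2 := by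
    rw [RotationSystem.eulerChar, Nat.card_eq_fintype_card, Nat.card_eq_fintype_card] at hφ ⊢
    omega
  refine ⟨⟨φ.reflect X, hrev.facesDirected φ.facesDirected, heuler⟩, ⟨?D, ?_⟩, hrev⟩
  case D => exact
    { inside := X
      x := (x, true)
      y := (y, false)
      edge_ne := hX.ne
      x_inside := hX.tail_x
      x_outside := hX.head_x
      y_inside := hX.head_y
      y_outside := hX.tail_y
      not_crossed := hX.tail_mem_iff
      arc_xy := hX.sameCycle_exitDart_entryDart φ.facesDirected true
      arc_yx := hX.sameCycle_exitDart_entryDart φ.facesDirected false }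
  exact hrev

/-! ### Equivalence of mirror images -/

theorem map_opp_reverse_map_opp_reverse (c : Cycle (E × Bool)) :
    ((c.reverse.map opp).reverse.map opp) = c := by
  induction c using Quotient.inductionOn' with
  | h l =>
    change (((l : Cycle (E × Bool)).reverse.map opp).reverse.map opp) = (l : Cycle (E × Bool))
    simp [Cycle.reverse_coe, Cycle.map_coe, ← List.map_reverse, Function.comp_def]

theorem equivalent_of_reversedOn_univ [Finite E] {φ ψ : H.SphereEmbedding}
    (h : φ.ReversedOn ψ.toRotationSystem Set.univ) : φ.Equivalent ψ := by
  have key {φ ψ : H.SphereEmbedding} (h : φ.ReversedOn ψ.toRotationSystem Set.univ) :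
      φ.facialWalks ⊆ ψ.facialWalks := by
    rintro w ⟨d, hw⟩
    have hd := Function.periodicOrbit_eq_map_reverse (f := opp)
      (fun a => h.facePerm_opp_facePerm (d := a) trivial) d
    refine ⟨opp (φ.facePerm.symm d), ?_⟩
    rw [hd]
    rcases hw with rfl | rfl
    · exact Or.inr (map_opp_reverse_map_opp_reverse _).symm
    · exact Or.inl rfl
  exact (key h).antisymm (key h.symm)

theorem equivalent_of_reversedOn_empty {φ ψ : H.SphereEmbedding}
    (h : φ.ReversedOn ψ.toRotationSystem ∅) : φ.Equivalent ψ := by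
  have : φ.facePerm = ψ.facePerm :=
    Equiv.ext fun d => (h.facePerm_of_notMem (Set.notMem_empty _)).symm
  rw [Equivalent, RotationSystem.facialWalks, this]
  rfl

/-- A Whitney flip along a cut of two edges within the cut of the reversed set `S` shrinks the cut
of `S`. When this cut is empty, `S` is empty or contains all vertices. -/
theorem exists_reflTransGen_equivalent [Fintype V] [Fintype E] (hr : H.IsTwoRegular)
    (hc : H.IsConnected) {S : Set V} {φ ψ : H.SphereEmbedding}
    (h : φ.ReversedOn ψ.toRotationSystem S) :
    ∃ χ : H.SphereEmbedding, Relation.ReflTransGen IsWhitneyFlip φ χ ∧ χ.Equivalent ψ := by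
  induction hn : (H.cut S).ncard using Nat.strong_induction_on generalizing S φ with
  | _ n ih =>
    subst hn
    rcases (H.cut S).eq_empty_or_nonempty with hS | hS
    · refine ⟨φ, .refl, ?_⟩
      have hconst (e : E) : H.tail e ∈ S ↔ H.head e ∈ S := by
        by_contra he
        exact Set.notMem_empty e (hS ▸ he)
      rcases S.eq_empty_or_nonempty with rfl | ⟨v, hv⟩
      · exact equivalent_of_reversedOn_empty h
      · obtain rfl : S = Set.univ := Set.eq_univ_of_forall (hc.of_forall_edge hconst hv)
        exact equivalent_of_reversedOn_univ h
    · obtain ⟨X, x, y, hX, hsub⟩ :=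
        h.exists_isTwoEdgeCut hc hr φ.eulerChar_eq ψ.eulerChar_eq hS
      obtain ⟨χ, hflip, hrev⟩ := φ.exists_isWhitneyFlip hc hX
      have hx : x ∈ H.cut X := by rw [hX.cut_eq]; exact Or.inl rfl
      have hlt : H.cut (symmDiff S X) ⊂ H.cut S := by
        refine (Set.ssubset_iff_of_subset fun e he => ?_).2 ⟨x, hsub hx, ?_⟩
        · have := @hsub e
          simp only [mem_cut, Set.mem_symmDiff] at he this ⊢
          tauto
        · have := hsub hx
          simp only [mem_cut, Set.mem_symmDiff] at hx this ⊢
          tauto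
      obtain ⟨ω, hω, heq⟩ := ih _ (Set.ncard_lt_ncard hlt (Set.toFinite _)) (h.symmDiff hrev) rfl
      exact ⟨ω, .head hflip hω, heq⟩

end SphereEmbedding

end MultiDigraph

theorem mainTheorem1 {V E : Type*} [Finite V] [Finite E] (H : MultiDigraph V E)
    (h_reg : H.IsTwoRegular) (h_conn : H.IsConnected) (φ₁ φ₂ : H.SphereEmbedding) :
    ∃ ψ : H.SphereEmbedding,
      Relation.ReflTransGen MultiDigraph.SphereEmbedding.IsWhitneyFlip φ₁ ψ ∧
        ψ.Equivalent φ₂ := by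
  have := Fintype.ofFinite V
  have := Fintype.ofFinite E
  obtain ⟨S, hS⟩ := φ₁.facesDirected.exists_reversedOn h_reg φ₂.facesDirected
  exact MultiDigraph.SphereEmbedding.exists_reflTransGen_equivalent h_reg h_conn hS
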